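/- For nonempty compact convex sets $K,C\subset\mathbb{R}^2$ write $h_C(a)=\max_{x\in C}\langle a,x\rangle$ for the support function and $$R(K,C)=\inf\{\rho\ge 0:\ \exists t\in\mathbb{R}^2,\ K\subset t+\rho C\},\qquad r(K,C)=\sup\{\rho\ge 0:\ \exists t\in\mathbb{R}^2,\ t+\rho C\subset K\},$$ $$D_{\mathrm{MAX}}(K,C)=\max_{s\in\mathbb{R}^2\setminus\{0\}}\frac{h_K(s)+h_K(-s)}{\max(h_C(s),h_C(-s))}$$ for the circumradius, the inradius and the maximum diameter of $K$ with respect to the gauge $C$. With the Minkowski asymmetry $s(C)=R(C,-C)$, the set $C$ is called Minkowski-centered if $C\subset -s(C)C$ and $R(C,-s(C)C)=1$. The $(r,R,D_{\mathrm{MAX}})$ Blaschke–Santaló diagram of $C$ is the set $$f_{\mathrm{MAX}}(\bar{\mathcal C}^2,C)=\left\{\left(\frac{r(K,C)}{R(K,C)},\frac{D_{\mathrm{MAX}}(K,C)}{2R(K,C)}\right):\ K\in\bar{\mathcal C}^2\right\},$$ where $\bar{\mathcal C}^2$ is the family of nonempty compact convex subsets of $\mathbb{R}^2$ that are not single points.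 **Theorem.** Let $S\subset\mathbb{R}^2$ be a Minkowski-centered (nondegenerate) triangle. Then $f_{\mathrm{MAX}}(\bar{\mathcal C}^2,S)$ is exactly the set of all points $\left(\frac rR,\frac{D}{2R}\right)$ with real numbers $r$, $R>0$, $D$ satisfying $$\frac D2\le R,\qquad r\le\frac D2,\qquad 0\le r,\qquad R\le D,\qquad \left(\frac DR-\frac12\right)\left(\frac32-\frac DR\right)\le\frac rR .$$ -/

import Mathlib

open scoped Pointwise

noncomputable section

/-- The support function `h_C(a) = max_{x ∈ C} ⟨a, x⟩`. -/
def supportFn {n : ℕ} (C : Set (EuclideanSpace ℝ (Fin n))) (a : EuclideanSpace ℝ (Fin n)) : ℝ :=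
  sSup ((fun x => inner ℝ a x) '' C)

/-- The circumradius `R(K, C)` of `K` with respect to the gauge `C`. -/
def circumradius {n : ℕ} (K C : Set (EuclideanSpace ℝ (Fin n))) : ℝ :=
  sInf {ρ : ℝ | 0 ≤ ρ ∧ ∃ t : EuclideanSpace ℝ (Fin n), K ⊆ t +ᵥ ρ • C}

/-- The inradius `r(K, C)` of `K` with respect to the gauge `C`. -/
def inradius {n : ℕ} (K C : Set (EuclideanSpace ℝ (Fin n))) : ℝ :=
  sSup {ρ : ℝ | 0 ≤ ρ ∧ ∃ t : EuclideanSpace ℝ (Fin n), t +ᵥ ρ • C ⊆ K}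

/-- `K` is optimally contained in `C`. -/
def OptContained {n : ℕ} (K C : Set (EuclideanSpace ℝ (Fin n))) : Prop :=
  K ⊆ C ∧ circumradius K C = 1

/-- The Minkowski asymmetry `s(C) = R(C, -C)`. -/
def minkowskiAsymmetry {n : ℕ} (C : Set (EuclideanSpace ℝ (Fin n))) : ℝ :=
  circumradius C (-C)

/-- `C` is Minkowski-centered: it is optimally contained in `-s(C) C`. -/
def IsMinkowskiCentered {n : ℕ} (C : Set (EuclideanSpace ℝ (Fin n))) : Prop :=
  OptContained C ((-minkowskiAsymmetry C) • C)

/-- The `s`-breadth `(h_K(s) + h_K(-s)) / max (h_C(s), h_C(-s))`. -/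
def breadthMax {n : ℕ} (s : EuclideanSpace ℝ (Fin n)) (K C : Set (EuclideanSpace ℝ (Fin n))) : ℝ :=
  (supportFn K s + supportFn K (-s)) / max (supportFn C s) (supportFn C (-s))

/-- The maximum diameter `D_MAX(K, C)`: the maximal `s`-breadth over all `s ≠ 0`. -/
def diameterMax {n : ℕ} (K C : Set (EuclideanSpace ℝ (Fin n))) : ℝ :=
  sSup {b : ℝ | ∃ s : EuclideanSpace ℝ (Fin n), s ≠ 0 ∧ b = breadthMax s K C}

/-- The map `f_MAX(K, C) = (r(K, C) / R(K, C), D_MAX(K, C) / (2 R(K, C)))`. -/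
def diagramMapMax {n : ℕ} (K C : Set (EuclideanSpace ℝ (Fin n))) : ℝ × ℝ :=
  (inradius K C / circumradius K C, diameterMax K C / (2 * circumradius K C))

/-- The `(r, R, D_MAX)` Blaschke–Santaló diagram with respect to `C`: the image under `f_MAX(·, C)`
of the convex bodies (nonempty compact convex sets) that are not single points. -/
def diagramMax {n : ℕ} (C : Set (EuclideanSpace ℝ (Fin n))) : Set (ℝ × ℝ) :=
  {p | ∃ K : ConvexBody (EuclideanSpace ℝ (Fin n)),
    (K : Set (EuclideanSpace ℝ (Fin n))).Nontrivial ∧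
      p = diagramMapMax (K : Set (EuclideanSpace ℝ (Fin n))) C}

/-- A (nondegenerate) triangle in the plane. -/
def IsTriangle (S : Set (EuclideanSpace ℝ (Fin 2))) : Prop :=
  ∃ p : Fin 3 → EuclideanSpace ℝ (Fin 2),
    AffineIndependent ℝ p ∧ S = convexHull ℝ (Set.range p)

end

/-!
Minkowski-centeredness places the centroid of the triangle `S` at the origin, so that `S` is given
by `ℓ i ≥ -1 / 3` for the linear parts `ℓ i` of its barycentric coordinates
(`exists_isCenteredFrame`). In these terms the three functionals of a compact convex set `K` become
elementary:

* `R(K, S) = -∑ i, min_K ℓ i` (`circumradius_eq`);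
* `max (h_S, h_{-S})` is the support function of the hexagon `conv (S ∪ -S)`, whose edges are
  normal to the functionals `ℓ i - ℓ j`, so `D_MAX(K, S)` is the largest width of `K` with respect
  to these three functionals (`diameterMax_le`, `le_diameterMax`);
* `r(K, S)` is bounded below by any inscribed homothet and above by any three half-planes that
  contain `K` and whose normals sum to zero (`le_inradius`, `inradius_le`).

For the necessity of the inequalities, normalize `R = 1` and choose points of `K` on the three sides
of the circumscribed homothet, dividing them in the ratios `a : 1 - a`, `b : 1 - b`, `c : 1 - c`.
The largest homothet inscribed in the triangle of these points has size
`1 - (a + b + c) + (ab + bc + ca)`, and `D` is at least `1 + a - b`, `1 + b - c` and `1 + c - a`.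
The last inequality of the theorem is then the elementary `contact_inequality`, and `R ≤ D` follows
by adding up the three lower bounds for `D`.

Conversely, for each admissible diameter there is an extremal contact triangle (for `D ≤ 3 / 2`) or
a segment (for `D ≥ 3 / 2`). Its convex hull with a homothet of size `r` in a suitable position has
the prescribed circumradius and diameter, and the half-planes of `inradius_le` certify that its
inradius is exactly `r` (`mem_diagramMax_of_le`, `mem_diagramMax_of_ge`).
-/

/-- The plane, with its Euclidean structure. -/
local notation "Pl" => EuclideanSpace ℝ (Fin 2)

/-! ### Barycentric coordinates and support functions -/

/-- `p` lists the vertices of a triangle with centroid `0`, and `ℓ i` is the linear part of its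
`i`-th barycentric coordinate, so that this coordinate is `ℓ i + 1 / 3`. -/
structure IsCenteredFrame (p : Fin 3 → Pl) (ℓ : Fin 3 → Pl →ₗ[ℝ] ℝ) : Prop where
  sum_coord : ∀ x, ℓ 0 x + ℓ 1 x + ℓ 2 x = 0
  eq_sum : ∀ x, x = ℓ 0 x • p 0 + ℓ 1 x • p 1 + ℓ 2 x • p 2
  sum_vertex : p 0 + p 1 + p 2 = 0
  coord_vertex : ∀ i j, ℓ i (p j) = if i = j then 2 / 3 else -1 / 3

/-- A linear functional on the plane is the inner product with a vector. -/
lemma exists_inner_eq (f : Pl →ₗ[ℝ] ℝ) : ∃ s : Pl, ∀ x, inner ℝ s x = f x :=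
  ⟨(InnerProductSpace.toDual ℝ Pl).symm (LinearMap.toContinuousLinearMap f), fun x => by simp⟩

lemma bddAbove_inner_image {K : Set Pl} (hK : IsCompact K) (s : Pl) :
    BddAbove ((fun x => inner ℝ s x) '' K) :=
  (hK.image (by fun_prop)).bddAbove

lemma inner_le_supportFn {K : Set Pl} (hK : IsCompact K) (s : Pl) {x : Pl} (hx : x ∈ K) :
    inner ℝ s x ≤ supportFn K s :=
  le_csSup (bddAbove_inner_image hK s) ⟨x, hx, rfl⟩

lemma supportFn_le {K : Set Pl} (hK : K.Nonempty) {s : Pl} {c : ℝ}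
    (h : ∀ x ∈ K, inner ℝ s x ≤ c) : supportFn K s ≤ c :=
  csSup_le (hK.image _) (by rintro _ ⟨x, hx, rfl⟩; exact h x hx)

lemma isCompact_convexHull_range {ι : Type*} [Finite ι] (p : ι → Pl) :
    IsCompact (convexHull ℝ (Set.range p)) :=
  (Set.finite_range p).isCompact_convexHull ℝ

lemma le_of_mem_convexHull {A : Set Pl} {f : Pl →ₗ[ℝ] ℝ} {c : ℝ}
    (h : ∀ x ∈ A, f x ≤ c) {x : Pl} (hx : x ∈ convexHull ℝ A) : f x ≤ c :=
  convexHull_min (fun y hy => h y hy) (convex_halfSpace_le f.isLinear c) hx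

namespace IsCenteredFrame

variable {p : Fin 3 → EuclideanSpace ℝ (Fin 2)}
  {ℓ : Fin 3 → EuclideanSpace ℝ (Fin 2) →ₗ[ℝ] ℝ}

lemma ext_coord (h : IsCenteredFrame p ℓ) {x y : Pl} (h0 : ℓ 0 x = ℓ 0 y)
    (h1 : ℓ 1 x = ℓ 1 y) : x = y := by
  have h2 : ℓ 2 x = ℓ 2 y := by linarith [h.sum_coord x, h.sum_coord y]
  rw [h.eq_sum x, h.eq_sum y, h0, h1, h2]

lemma mem_triangle_iff (h : IsCenteredFrame p ℓ) {x : Pl} :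
    x ∈ convexHull ℝ (Set.range p) ↔ ∀ i, -1 / 3 ≤ ℓ i x := by
  constructor
  · intro hx i
    have := le_of_mem_convexHull (A := Set.range p) (f := -ℓ i) (c := 1 / 3) (by
      rintro _ ⟨j, rfl⟩
      rw [LinearMap.neg_apply, h.coord_vertex]
      split_ifs <;> norm_num) hx
    rw [LinearMap.neg_apply] at this
    linarith
  · intro hx
    have hmem := (convex_convexHull ℝ (Set.range p)).sum_mem (t := Finset.univ)
      (w := fun i => ℓ i x + 1 / 3) (z := p) (fun i _ => by linarith [hx i])
      (by rw [Fin.sum_univ_three]; linarith [h.sum_coord x])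
      (fun i _ => subset_convexHull ℝ _ ⟨i, rfl⟩)
    have he : ∑ i, (ℓ i x + 1 / 3) • p i = x := by
      conv_rhs => rw [h.eq_sum x]
      rw [Fin.sum_univ_three]
      have := congrArg (fun v => (1 / 3 : ℝ) • v) h.sum_vertex
      simp only [smul_add, smul_zero] at this
      rw [add_smul, add_smul, add_smul, ← sub_eq_zero, ← this]
      abel
    rwa [he] at hmem

lemma mem_homothet_iff (h : IsCenteredFrame p ℓ) {t x : Pl} {ρ : ℝ} (hρ : 0 ≤ ρ) :
    x ∈ t +ᵥ ρ • convexHull ℝ (Set.range p) ↔ ∀ i, ℓ i t - ρ / 3 ≤ ℓ i x := by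
  constructor
  · rintro ⟨_, ⟨y, hy, rfl⟩, rfl⟩ i
    have := h.mem_triangle_iff.1 hy i
    simp only [vadd_eq_add, map_add, map_smul, smul_eq_mul]
    nlinarith
  · intro hx
    rcases hρ.eq_or_lt with rfl | hρ
    · have hxt : x = t := by
        have h0 := hx 0
        have h1 := hx 1
        have h2 := hx 2
        apply h.ext_coord <;> linarith [h.sum_coord x, h.sum_coord t]
      refine ⟨0, ⟨p 0, subset_convexHull ℝ _ ⟨0, rfl⟩, by simp⟩, by simp [hxt]⟩
    · refine ⟨x - t, ⟨ρ⁻¹ • (x - t), h.mem_triangle_iff.2 fun i => ?_, ?_⟩, by simp⟩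
      · rw [map_smul, map_sub, smul_eq_mul, inv_mul_eq_div, le_div_iff₀ hρ]
        linarith [hx i]
      · simp [smul_smul, hρ.ne']

/-- A homothet of the triangle lies in a convex set as soon as its vertices do. -/
lemma homothet_subset_iff {K : Set Pl} (hK : Convex ℝ K) {t : Pl} {ρ : ℝ} :
    t +ᵥ ρ • convexHull ℝ (Set.range p) ⊆ K ↔ ∀ i, t + ρ • p i ∈ K := by
  constructor
  · exact fun hs i => hs ⟨_, ⟨p i, subset_convexHull ℝ _ ⟨i, rfl⟩, rfl⟩, rfl⟩
  · intro hv
    rw [← convexHull_smul, ← convexHull_vadd]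
    refine convexHull_min ?_ hK
    rintro _ ⟨_, ⟨_, ⟨i, rfl⟩, rfl⟩, rfl⟩
    exact hv i

/-! ### The circumradius -/

/-- If `K` attains the minimum of each barycentric coordinate of the triangle at `q i`, the
smallest circumscribed homothet is the one whose three sides pass through the points `q i`. -/
lemma circumradius_eq (h : IsCenteredFrame p ℓ) {K : Set Pl} {q : Fin 3 → Pl}
    (hq : ∀ i, q i ∈ K) (hmin : ∀ i, ∀ x ∈ K, ℓ i (q i) ≤ ℓ i x) :
    circumradius K (convexHull ℝ (Set.range p)) = -(ℓ 0 (q 0) + ℓ 1 (q 1) + ℓ 2 (q 2)) := by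
  set R := -(ℓ 0 (q 0) + ℓ 1 (q 1) + ℓ 2 (q 2)) with hR
  have hR0 : 0 ≤ R := by
    linarith [h.sum_coord (q 0), hmin 1 _ (hq 0), hmin 2 _ (hq 0)]
  refine IsLeast.csInf_eq ⟨⟨hR0, ∑ i, (ℓ i (q i) + R / 3) • p i, fun x hx => ?_⟩, ?_⟩
  · rw [h.mem_homothet_iff hR0]
    intro i
    refine le_trans (le_of_eq ?_) (hmin i x hx)
    rw [Fin.sum_univ_three]
    fin_cases i <;> simp [h.coord_vertex] <;> linarith
  · rintro ρ ⟨hρ, t, hs⟩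
    have h0 := (h.mem_homothet_iff hρ).1 (hs (hq 0)) 0
    have h1 := (h.mem_homothet_iff hρ).1 (hs (hq 1)) 1
    have h2 := (h.mem_homothet_iff hρ).1 (hs (hq 2)) 2
    linarith [h.sum_coord t]

/-! ### The maximum diameter -/

/-- The polar form of the fact that the edges of the hexagon `conv (S ∪ -S)` are the level sets of
the functionals `ℓ i - ℓ j`. -/
lemma sum_mul_le {d σ : Fin 3 → ℝ} {D N : ℝ} (hσ : σ 0 + σ 1 + σ 2 = 0)
    (hN : ∀ i, |σ i| ≤ N) (hd : ∀ i j, d i - d j ≤ D) :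
    d 0 * σ 0 + d 1 * σ 1 + d 2 * σ 2 ≤ D * N := by
  have hD : 0 ≤ D := by simpa using hd 0 0
  -- Two of the three numbers have the same sign; eliminate the third one.
  have key : ∀ i j k : Fin 3, σ i + σ j + σ k = 0 → 0 ≤ σ i * σ j →
      d i * σ i + d j * σ j + d k * σ k ≤ D * N := by
    intro i j k hs hij
    have hk : σ k = -(σ i + σ j) := by linarith
    have hb := abs_le.1 (hN k)
    rw [hk] at hb ⊢
    rcases mul_nonneg_iff.1 hij with ⟨hi, hj⟩ | ⟨hi, hj⟩
    · linarith [mul_le_mul_of_nonneg_left (hd i k) hi, mul_le_mul_of_nonneg_left (hd j k) hj,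
        mul_le_mul_of_nonneg_left hb.1 hD]
    · linarith [mul_le_mul_of_nonneg_left (hd k i) (neg_nonneg.2 hi),
        mul_le_mul_of_nonneg_left (hd k j) (neg_nonneg.2 hj),
        mul_le_mul_of_nonneg_left hb.2 hD]
  by_cases h01 : 0 ≤ σ 0 * σ 1
  · exact key 0 1 2 hσ h01
  by_cases h12 : 0 ≤ σ 1 * σ 2
  · linarith [key 1 2 0 (by linarith) h12]
  by_cases h02 : 0 ≤ σ 0 * σ 2
  · linarith [key 0 2 1 (by linarith) h02]
  exfalso
  push Not at h01 h12 h02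
  have := mul_pos_of_neg_of_neg h01 h12
  nlinarith [mul_self_nonneg (σ 1)]

lemma abs_inner_vertex_le (s : Pl) (i : Fin 3) :
    |inner ℝ s (p i)| ≤ max (supportFn (convexHull ℝ (Set.range p)) s)
      (supportFn (convexHull ℝ (Set.range p)) (-s)) := by
  have hp : p i ∈ convexHull ℝ (Set.range p) := subset_convexHull ℝ _ ⟨i, rfl⟩
  have h1 := inner_le_supportFn (isCompact_convexHull_range p) s hp
  have h2 := inner_le_supportFn (isCompact_convexHull_range p) (-s) hp
  rw [inner_neg_left] at h2
  exact abs_le'.2 ⟨h1.trans (le_max_left _ _), h2.trans (le_max_right _ _)⟩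

lemma inner_eq_sum (h : IsCenteredFrame p ℓ) (s x : Pl) :
    inner ℝ s x =
      ℓ 0 x * inner ℝ s (p 0) + ℓ 1 x * inner ℝ s (p 1) + ℓ 2 x * inner ℝ s (p 2) := by
  conv_lhs => rw [h.eq_sum x]
  simp only [inner_add_right, real_inner_smul_right]

lemma gauge_pos (h : IsCenteredFrame p ℓ) {s : Pl} (hs : s ≠ 0) :
    0 < max (supportFn (convexHull ℝ (Set.range p)) s)
      (supportFn (convexHull ℝ (Set.range p)) (-s)) := by
  by_contra! hle
  have hz : ∀ i, inner ℝ s (p i) = 0 := fun i =>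
    abs_nonpos_iff.1 ((abs_inner_vertex_le s i).trans hle)
  have := h.inner_eq_sum s s
  simp only [hz, mul_zero, add_zero, inner_self_eq_zero] at this
  exact hs this

lemma breadthMax_le (h : IsCenteredFrame p ℓ) {K : Set Pl} (hK : K.Nonempty) {D : ℝ}
    (hD : ∀ x ∈ K, ∀ y ∈ K, ∀ i j, (ℓ i x - ℓ j x) - (ℓ i y - ℓ j y) ≤ D) {s : Pl}
    (hs : s ≠ 0) : breadthMax s K (convexHull ℝ (Set.range p)) ≤ D := by
  rw [breadthMax, div_le_iff₀ (h.gauge_pos hs)]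
  set N := max (supportFn (convexHull ℝ (Set.range p)) s)
      (supportFn (convexHull ℝ (Set.range p)) (-s))
  have key : ∀ x ∈ K, ∀ y ∈ K, inner ℝ s x + inner ℝ (-s) y ≤ D * N := by
    intro x hx y hy
    have hσ : inner ℝ s (p 0) + inner ℝ s (p 1) + inner ℝ s (p 2) = 0 := by
      rw [← inner_add_right, ← inner_add_right, h.sum_vertex, inner_zero_right]
    have := sum_mul_le (D := D) (d := fun i => ℓ i x - ℓ i y)
      (σ := fun i => inner ℝ s (p i)) hσ
      (abs_inner_vertex_le s) (fun i j => by linarith [hD x hx y hy i j])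
    rw [inner_neg_left, h.inner_eq_sum s x, h.inner_eq_sum s y]
    linarith
  have h1 : supportFn K s ≤ D * N - supportFn K (-s) := by
    refine supportFn_le hK fun x hx => ?_
    have := supportFn_le hK (s := -s) (c := D * N - inner ℝ s x)
      fun y hy => by linarith [key x hx y hy]
    linarith
  linarith

lemma diameterMax_le (h : IsCenteredFrame p ℓ) {K : Set Pl} (hK : K.Nonempty) {D : ℝ}
    (hD : ∀ x ∈ K, ∀ y ∈ K, ∀ i j, (ℓ i x - ℓ j x) - (ℓ i y - ℓ j y) ≤ D) :
    diameterMax K (convexHull ℝ (Set.range p)) ≤ D := by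
  obtain ⟨x, hx⟩ := hK
  refine Real.sSup_le ?_ (by simpa using hD x hx x hx 0 0)
  rintro _ ⟨s, hs, rfl⟩
  exact h.breadthMax_le ⟨x, hx⟩ hD hs

lemma bddAbove_breadthMax (h : IsCenteredFrame p ℓ) {K : Set Pl} (hK : K.Nonempty)
    (hc : IsCompact K) :
    BddAbove {b : ℝ | ∃ s : Pl, s ≠ 0 ∧ b = breadthMax s K (convexHull ℝ (Set.range p))} := by
  have hb : ∀ i, ∃ C, ∀ x ∈ K, ‖ℓ i x‖ ≤ C := fun i =>
    hc.exists_bound_of_continuousOn (ℓ i).continuous_of_finiteDimensional.continuousOn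
  choose C hC using hb
  refine ⟨4 * (|C 0| + |C 1| + |C 2|), ?_⟩
  rintro _ ⟨s, hs, rfl⟩
  have hCi : ∀ i, ∀ x ∈ K, |ℓ i x| ≤ |C 0| + |C 1| + |C 2| := by
    intro i x hx
    have h1 : |ℓ i x| ≤ |C i| := (hC i x hx).trans (le_abs_self _)
    have h0 := abs_nonneg (C 0)
    have h2 := abs_nonneg (C 1)
    have h3 := abs_nonneg (C 2)
    fin_cases i <;> simp only [Fin.zero_eta, Fin.mk_one, Fin.reduceFinMk] at * <;> linarith
  refine h.breadthMax_le hK (fun x hx y hy i j => ?_) hs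
  linarith [abs_le.1 (hCi i x hx), abs_le.1 (hCi j x hx), abs_le.1 (hCi i y hy),
    abs_le.1 (hCi j y hy)]

lemma le_diameterMax (h : IsCenteredFrame p ℓ) {K : Set Pl} (hc : IsCompact K) {x y : Pl}
    (hx : x ∈ K) (hy : y ∈ K) {i j : Fin 3} (hij : i ≠ j) :
    (ℓ i x - ℓ j x) - (ℓ i y - ℓ j y) ≤ diameterMax K (convexHull ℝ (Set.range p)) := by
  obtain ⟨s, hs⟩ := exists_inner_eq (ℓ i - ℓ j)
  have hs0 : s ≠ 0 := by
    rintro rfl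
    have := hs (p i)
    simp only [inner_zero_left, LinearMap.sub_apply, h.coord_vertex, if_neg hij.symm] at this
    norm_num at this
  refine le_trans ?_ (le_csSup (h.bddAbove_breadthMax ⟨x, hx⟩ hc) ⟨s, hs0, rfl⟩)
  have hv : ∀ k, |(ℓ i - ℓ j) (p k)| ≤ 1 := by
    intro k
    simp only [LinearMap.sub_apply, h.coord_vertex]
    split_ifs <;> norm_num
  have hle : max (supportFn (convexHull ℝ (Set.range p)) s)
      (supportFn (convexHull ℝ (Set.range p)) (-s)) ≤ 1 := by
    have hne : (convexHull ℝ (Set.range p)).Nonempty := ⟨p 0, subset_convexHull ℝ _ ⟨0, rfl⟩⟩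
    refine max_le (supportFn_le hne fun z hz => ?_) (supportFn_le hne fun z hz => ?_)
    · rw [hs]
      exact le_of_mem_convexHull (by rintro _ ⟨k, rfl⟩; exact (abs_le'.1 (hv k)).1) hz
    · rw [inner_neg_left, hs, ← LinearMap.neg_apply]
      exact le_of_mem_convexHull (by rintro _ ⟨k, rfl⟩; exact (abs_le'.1 (hv k)).2) hz
  have hw : ∀ u ∈ K, ∀ v ∈ K,
      (ℓ i u - ℓ j u) - (ℓ i v - ℓ j v) ≤ supportFn K s + supportFn K (-s) := by
    intro u hu v hv
    have h1 := inner_le_supportFn hc s hu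
    have h2 := inner_le_supportFn hc (-s) hv
    rw [inner_neg_left] at h2
    rw [hs, LinearMap.sub_apply] at h1 h2
    linarith
  rw [breadthMax, le_div_iff₀ (h.gauge_pos hs0)]
  have h1 := hw x hx y hy
  have h2 := hw x hx x hx
  have h3 := h.gauge_pos hs0
  rcases le_total 0 ((ℓ i x - ℓ j x) - (ℓ i y - ℓ j y)) with hn | hn <;> nlinarith

/-! ### The inradius -/

lemma two_mul_le_diameterMax (h : IsCenteredFrame p ℓ) {K : Set Pl} (hc : IsCompact K)
    {ρ : ℝ} {t : Pl} (ht : t +ᵥ ρ • convexHull ℝ (Set.range p) ⊆ K) :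
    2 * ρ ≤ diameterMax K (convexHull ℝ (Set.range p)) := by
  have hv : ∀ i, t + ρ • p i ∈ K := fun i =>
    ht ⟨_, ⟨p i, subset_convexHull ℝ _ ⟨i, rfl⟩, rfl⟩, rfl⟩
  have := h.le_diameterMax hc (hv 0) (hv 1) (i := 0) (j := 1) (by decide)
  simp [h.coord_vertex] at this
  linarith

lemma bddAbove_inradius (h : IsCenteredFrame p ℓ) {K : Set Pl} (hc : IsCompact K) :
    BddAbove {ρ : ℝ | 0 ≤ ρ ∧ ∃ t : Pl, t +ᵥ ρ • convexHull ℝ (Set.range p) ⊆ K} := by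
  refine ⟨diameterMax K (convexHull ℝ (Set.range p)) / 2, ?_⟩
  rintro ρ ⟨-, t, ht⟩
  linarith [h.two_mul_le_diameterMax hc ht]

lemma inradius_le_half_diameterMax (h : IsCenteredFrame p ℓ) {K : Set Pl} (hK : K.Nonempty)
    (hc : IsCompact K) :
    inradius K (convexHull ℝ (Set.range p)) ≤
      diameterMax K (convexHull ℝ (Set.range p)) / 2 := by
  obtain ⟨x, hx⟩ := hK
  refine csSup_le ⟨0, le_rfl, x, ?_⟩ ?_
  · rintro _ ⟨_, ⟨y, -, rfl⟩, rfl⟩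
    simpa using hx
  · rintro ρ ⟨-, t, ht⟩
    linarith [h.two_mul_le_diameterMax hc ht]

lemma le_inradius (h : IsCenteredFrame p ℓ) {K : Set Pl} (hK : Convex ℝ K) (hc : IsCompact K)
    {ρ : ℝ} (hρ : 0 ≤ ρ) {t : Pl} (ht : ∀ i, t + ρ • p i ∈ K) :
    ρ ≤ inradius K (convexHull ℝ (Set.range p)) :=
  le_csSup (h.bddAbove_inradius hc) ⟨hρ, t, (homothet_subset_iff hK).2 ht⟩

/-- Three half-planes `n k ≤ c k` containing `K`, whose normals sum to zero, bound the inradius: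
evaluate `n k` at the `k`-th vertex of an inscribed homothet and add up. -/
lemma inradius_le {K : Set Pl} {n : Fin 3 → Pl →ₗ[ℝ] ℝ} {c : Fin 3 → ℝ} {ρ : ℝ} (hρ : 0 ≤ ρ)
    (hn : ∀ x, n 0 x + n 1 x + n 2 x = 0) (hc : ∀ k, ∀ x ∈ K, n k x ≤ c k)
    (hpos : 0 < n 0 (p 0) + n 1 (p 1) + n 2 (p 2))
    (hle : c 0 + c 1 + c 2 ≤ ρ * (n 0 (p 0) + n 1 (p 1) + n 2 (p 2))) :
    inradius K (convexHull ℝ (Set.range p)) ≤ ρ := by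
  refine Real.sSup_le ?_ hρ
  rintro ρ' ⟨-, t, ht⟩
  have hv : ∀ k, n k t + ρ' * n k (p k) ≤ c k := fun k => by
    have := hc k _ (ht ⟨_, ⟨p k, subset_convexHull ℝ _ ⟨k, rfl⟩, rfl⟩, rfl⟩)
    simpa using this
  refine le_of_mul_le_mul_right ?_ hpos
  linarith [hv 0, hv 1, hv 2, hn t]

end IsCenteredFrame

/-! ### Minkowski-centered triangles -/

/-- A Minkowski-centered triangle has asymmetry `2` and centroid `0`. -/
lemma exists_isCenteredFrame {S : Set Pl} (hS : IsTriangle S) (hc : IsMinkowskiCentered S) :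
    ∃ p ℓ, IsCenteredFrame p ℓ ∧ S = convexHull ℝ (Set.range p) := by
  obtain ⟨p, hp, rfl⟩ := hS
  have htop : affineSpan ℝ (Set.range p) = ⊤ := by
    rw [hp.affineSpan_eq_top_iff_card_eq_finrank_add_one]
    simp
  let b : AffineBasis (Fin 3) ℝ Pl := ⟨p, hp, htop⟩
  have hS : convexHull ℝ (Set.range p) = {x | ∀ i, 0 ≤ b.coord i x} :=
    b.convexHull_eq_nonneg_coord
  let ℓ : Fin 3 → Pl →ₗ[ℝ] ℝ := fun i => (b.coord i).linear
  let c : Fin 3 → ℝ := fun i => b.coord i 0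
  have hdec : ∀ i x, b.coord i x = ℓ i x + c i := fun i x =>
    congrFun (b.coord i).decomp x
  have hsum : ∀ x, b.coord 0 x + b.coord 1 x + b.coord 2 x = 1 := fun x => by
    have := b.sum_coord_apply_eq_one x
    rwa [Fin.sum_univ_three] at this
  have hcomb : ∀ x, x = b.coord 0 x • p 0 + b.coord 1 x • p 1 + b.coord 2 x • p 2 := fun x => by
    have := b.linear_combination_coord_eq_self x
    rw [Fin.sum_univ_three] at this
    exact this.symm
  have hbp : ∀ i j, b.coord i (p j) = if i = j then 1 else 0 := fun i j => b.coord_apply i j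
  have hc1 : c 0 + c 1 + c 2 = 1 := hsum 0
  have hmem : ∀ i, p i ∈ convexHull ℝ (Set.range p) := fun i =>
    subset_convexHull ℝ _ ⟨i, rfl⟩
  -- The inclusion `S ⊆ t - ρ S`, read off in the `i`-th barycentric coordinate of `p i`.
  have key : ∀ (t : Pl) (ρ : ℝ), 0 ≤ ρ → (∀ i, ∃ y ∈ convexHull ℝ (Set.range p),
      p i = t - ρ • y) → ∀ i, 1 ≤ c i + ℓ i t + ρ * c i := by
    intro t ρ hρ hs i
    obtain ⟨y, hy, hpy⟩ := hs i
    rw [hS] at hy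
    have h1 := hy i
    have h2 := hbp i i
    rw [hdec] at h1 h2
    rw [hpy, map_sub, map_smul, smul_eq_mul, if_pos rfl] at h2
    nlinarith
  have hℓ0 : ∀ x, ℓ 0 x + ℓ 1 x + ℓ 2 x = 0 := fun x => by
    have := hsum x
    simp only [hdec] at this
    linarith
  have hasym : minkowskiAsymmetry (convexHull ℝ (Set.range p)) = 2 := by
    refine IsLeast.csInf_eq ⟨⟨by norm_num, p 0 + p 1 + p 2, fun x hx => ?_⟩, ?_⟩
    · refine ⟨x - (p 0 + p 1 + p 2), ⟨(1 / 2 : ℝ) • (x - (p 0 + p 1 + p 2)), ?_, ?_⟩, by simp⟩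
      · rw [hS] at hx
        rw [Set.mem_neg, hS]
        intro i
        have hx' : b.coord i x ≤ 1 := by
          have h0 := hx 0
          have h1 := hx 1
          have h2 := hx 2
          have h3 := hsum x
          fin_cases i <;> simp only [Fin.zero_eta, Fin.mk_one, Fin.reduceFinMk] <;> linarith
        have hps : ℓ i (p 0) + ℓ i (p 1) + ℓ i (p 2) = 1 - 3 * c i := by
          have h0 := hbp i 0
          have h1 := hbp i 1
          have h2 := hbp i 2
          rw [hdec] at h0 h1 h2
          fin_cases i <;> simp at h0 h1 h2 ⊢ <;> linarith
        rw [hdec] at hx' ⊢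
        rw [map_neg, map_smul, map_sub, map_add, map_add, hps, smul_eq_mul]
        linarith
      · simp [smul_smul]
    · rintro ρ ⟨hρ, t, hs⟩
      have h1 := key t ρ hρ fun i => by
        obtain ⟨_, ⟨y, hy, rfl⟩, he⟩ := hs (hmem i)
        exact ⟨-y, hy, by rw [← he]; simp⟩
      have h2 := h1 0
      have h3 := h1 1
      have h4 := h1 2
      nlinarith [hℓ0 t]
  have hc3 : ∀ i, c i = 1 / 3 := by
    have hsub := hc.1
    rw [hasym] at hsub
    have h1 := key 0 2 (by norm_num) fun i => by
      obtain ⟨y, hy, he⟩ := hsub (hmem i)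
      exact ⟨y, hy, by rw [← he]; simp⟩
    simp only [map_zero] at h1
    have h2 := h1 0
    have h3 := h1 1
    have h4 := h1 2
    intro i
    fin_cases i <;> simp only [Fin.zero_eta, Fin.mk_one, Fin.reduceFinMk] <;> linarith
  have hp0 : p 0 + p 1 + p 2 = 0 := by
    have h0 := hcomb 0
    have h1 : ∀ i, b.coord i 0 = 1 / 3 := hc3
    rw [h1, h1, h1, ← smul_add, ← smul_add] at h0
    exact (smul_eq_zero.1 h0.symm).resolve_left (by norm_num)
  refine ⟨p, ℓ, ⟨hℓ0, fun x => ?_, hp0, fun i j => ?_⟩, rfl⟩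
  · have h0 := hcomb x
    simp only [hdec, hc3, add_smul] at h0
    have h1 := congrArg (fun v => (1 / 3 : ℝ) • v) hp0
    simp only [smul_add, smul_zero] at h1
    rw [← add_zero (ℓ 0 x • p 0 + ℓ 1 x • p 1 + ℓ 2 x • p 2), ← h1]
    refine h0.trans ?_
    abel
  · have h0 := hbp i j
    rw [hdec, hc3] at h0
    split_ifs at h0 ⊢ <;> linarith

/-! ### The inequalities -/

namespace IsCenteredFrame

variable {p : Fin 3 → EuclideanSpace ℝ (Fin 2)}
  {ℓ : Fin 3 → EuclideanSpace ℝ (Fin 2) →ₗ[ℝ] ℝ}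

/-- If three points on the sides of a circumscribed homothet of size `R` divide these sides in the
ratios `a : 1 - a`, `b : 1 - b` and `c : 1 - c`, then the largest homothet inscribed in their
triangle has size `R (1 - (a + b + c) + (ab + bc + ca))`, and its vertices lie on the edges of the
triangle and divide them in the same ratios. -/
lemma le_inradius_of_contact (h : IsCenteredFrame p ℓ) {K : Set Pl} (hK : Convex ℝ K)
    (hc : IsCompact K) {q : Fin 3 → Pl} (hq : ∀ i, q i ∈ K) {R a b c : ℝ} (hR : 0 ≤ R)
    (ha : 0 ≤ a) (ha' : a ≤ 1) (hb : 0 ≤ b) (hb' : b ≤ 1) (hc0 : 0 ≤ c) (hc' : c ≤ 1)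
    (h01 : ℓ 1 (q 0) = ℓ 1 (q 1) + R * a) (h10 : ℓ 0 (q 1) = ℓ 0 (q 0) + R * (1 - b))
    (h20 : ℓ 0 (q 2) = ℓ 0 (q 0) + R * c) (h21 : ℓ 1 (q 2) = ℓ 1 (q 1) + R * (1 - c)) :
    R * (1 - (a + b + c) + (a * b + b * c + c * a)) ≤
      inradius K (convexHull ℝ (Set.range p)) := by
  set δ := 1 - (a + b + c) + (a * b + b * c + c * a) with hδ
  have hδ0 : 0 ≤ δ := by
    have h1 := mul_nonneg (mul_nonneg ha hb) hc0
    have h2 := mul_nonneg (mul_nonneg (sub_nonneg.2 ha') (sub_nonneg.2 hb')) (sub_nonneg.2 hc')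
    linarith
  have hv : ∀ i, ![(1 - a) • q 1 + a • q 2, b • q 0 + (1 - b) • q 2,
      (1 - c) • q 0 + c • q 1] i ∈ K := by
    intro i
    fin_cases i
    · exact hK (hq 1) (hq 2) (by linarith) ha (by ring)
    · exact hK (hq 0) (hq 2) hb (by linarith) (by ring)
    · exact hK (hq 0) (hq 1) (by linarith) hc0 (by ring)
  refine h.le_inradius hK hc (mul_nonneg hR hδ0)
    (t := (1 - a) • q 1 + a • q 2 - (R * δ) • p 0) fun i => ?_
  convert hv i using 1
  have hs := h.sum_coord (q 0)
  fin_cases i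
  · simp
  · apply h.ext_coord <;>
      simp [h.coord_vertex, h01, h10, h20, h21, hδ] <;> ring
  · apply h.ext_coord <;>
      simp [h.coord_vertex, h01, h10, h20, h21, hδ] <;> ring

/-- The inequality behind the lower bound on the inradius: after the substitution
`a = x + 1 / 2`, … it reads `xy + yz + zx + u² ≥ 0`, where `u` bounds the cyclic differences. -/
lemma contact_inequality {a b c d : ℝ} (h1 : 1 - b + a ≤ d) (h2 : 1 - c + b ≤ d)
    (h3 : 1 - a + c ≤ d) :
    (d - 1 / 2) * (3 / 2 - d) ≤ 1 - (a + b + c) + (a * b + b * c + c * a) := by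
  have hu := mul_nonneg (sub_nonneg.2 h1) (sub_nonneg.2 h2)
  have hv := mul_nonneg (sub_nonneg.2 h2) (sub_nonneg.2 h3)
  have hw := mul_nonneg (sub_nonneg.2 h3) (sub_nonneg.2 h1)
  nlinarith [sq_nonneg (a + b + c - 3 / 2)]

/-- Every point of the diagram satisfies the five inequalities. -/
lemma diagram_inequalities (h : IsCenteredFrame p ℓ) {K : Set Pl} (hK : Convex ℝ K)
    (hc : IsCompact K) (hnt : K.Nontrivial) :
    let S := convexHull ℝ (Set.range p)
    0 < circumradius K S ∧ diameterMax K S / 2 ≤ circumradius K S ∧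
      inradius K S ≤ diameterMax K S / 2 ∧ 0 ≤ inradius K S ∧
      circumradius K S ≤ diameterMax K S ∧
      (diameterMax K S / circumradius K S - 1 / 2) *
        (3 / 2 - diameterMax K S / circumradius K S) ≤ inradius K S / circumradius K S := by
  intro S
  have hex : ∀ i, ∃ x ∈ K, ∀ y ∈ K, ℓ i x ≤ ℓ i y := fun i => by
    obtain ⟨x, hx, hm⟩ := hc.exists_isMinOn hnt.nonempty
      (ℓ i).continuous_of_finiteDimensional.continuousOn
    exact ⟨x, hx, fun y hy => hm hy⟩
  choose q hq hmin using hex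
  have hReq : circumradius K S = -(ℓ 0 (q 0) + ℓ 1 (q 1) + ℓ 2 (q 2)) :=
    h.circumradius_eq hq hmin
  set R := circumradius K S
  set D := diameterMax K S with hD
  have hR0 : 0 ≤ R := by
    linarith [h.sum_coord (q 0), hmin 1 _ (hq 0), hmin 2 _ (hq 0)]
  have hR : 0 < R := by
    refine hR0.lt_of_ne' fun hz => ?_
    have heq : ∀ x ∈ K, x = q 0 := fun x hx => by
      apply h.ext_coord <;>
        linarith [h.sum_coord x, hmin 0 x hx, hmin 1 x hx, hmin 2 x hx,
          h.sum_coord (q 0), hmin 1 _ (hq 0), hmin 2 _ (hq 0)]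
    obtain ⟨x, hx, y, hy, hxy⟩ := hnt
    exact hxy ((heq x hx).trans (heq y hy).symm)
  obtain ⟨a, ha⟩ : ∃ a, R * a = ℓ 1 (q 0) - ℓ 1 (q 1) := ⟨_, mul_div_cancel₀ _ hR.ne'⟩
  obtain ⟨b, hb⟩ : ∃ b, R * b = ℓ 2 (q 1) - ℓ 2 (q 2) := ⟨_, mul_div_cancel₀ _ hR.ne'⟩
  obtain ⟨c, hc'⟩ : ∃ c, R * c = ℓ 0 (q 2) - ℓ 0 (q 0) := ⟨_, mul_div_cancel₀ _ hR.ne'⟩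
  have hs0 := h.sum_coord (q 0)
  have hs1 := h.sum_coord (q 1)
  have hs2 := h.sum_coord (q 2)
  have hm01 := hmin 1 _ (hq 0)
  have hm02 := hmin 2 _ (hq 0)
  have hm10 := hmin 0 _ (hq 1)
  have hm12 := hmin 2 _ (hq 1)
  have hm20 := hmin 0 _ (hq 2)
  have hm21 := hmin 1 _ (hq 2)
  have hd1 : R * (1 - b + a) ≤ D := by
    linarith [h.le_diameterMax hc (hq 1) (hq 0) (i := 0) (j := 1) (by decide)]
  have hd2 : R * (1 - c + b) ≤ D := by
    linarith [h.le_diameterMax hc (hq 2) (hq 1) (i := 1) (j := 2) (by decide)]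
  have hd3 : R * (1 - a + c) ≤ D := by
    linarith [h.le_diameterMax hc (hq 0) (hq 2) (i := 2) (j := 0) (by decide)]
  have hr := h.le_inradius_of_contact hK hc hq hR0 (a := a) (b := b) (c := c)
    (nonneg_of_mul_nonneg_right (by linarith) hR) (le_of_mul_le_mul_left (by linarith) hR)
    (nonneg_of_mul_nonneg_right (by linarith) hR) (le_of_mul_le_mul_left (by linarith) hR)
    (nonneg_of_mul_nonneg_right (by linarith) hR) (le_of_mul_le_mul_left (by linarith) hR)
    (by linarith) (by linarith) (by linarith) (by linarith)
  refine ⟨hR, ?_, h.inradius_le_half_diameterMax hnt.nonempty hc,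
    Real.sSup_nonneg fun _ hx => hx.1, by linarith, ?_⟩
  · have : D ≤ 2 * R := h.diameterMax_le hnt.nonempty fun x hx y hy i j => by
      have hx0 := hmin 0 x hx
      have hx1 := hmin 1 x hx
      have hx2 := hmin 2 x hx
      have hy0 := hmin 0 y hy
      have hy1 := hmin 1 y hy
      have hy2 := hmin 2 y hy
      have hx3 := h.sum_coord x
      have hy3 := h.sum_coord y
      fin_cases i <;> fin_cases j <;>
        simp only [Fin.zero_eta, Fin.mk_one, Fin.reduceFinMk] <;> linarith
    linarith
  · refine (contact_inequality (a := a) (b := b) (c := c) ?_ ?_ ?_).trans ?_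
    · rw [le_div_iff₀ hR]; linarith
    · rw [le_div_iff₀ hR]; linarith
    · rw [le_div_iff₀ hR]; linarith
    · rw [le_div_iff₀ hR]; linarith

end IsCenteredFrame

/-! ### Bodies with prescribed radii and diameter -/

namespace IsCenteredFrame

variable {p : Fin 3 → EuclideanSpace ℝ (Fin 2)}
  {ℓ : Fin 3 → EuclideanSpace ℝ (Fin 2) →ₗ[ℝ] ℝ}

lemma coord_combination (h : IsCenteredFrame p ℓ) (x : Fin 3 → ℝ)
    (hx : x 0 + x 1 + x 2 = 1) (i : Fin 3) :
    ℓ i (x 0 • p 0 + x 1 • p 1 + x 2 • p 2) = x i - 1 / 3 := by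
  fin_cases i <;> simp [h.coord_vertex] <;> linarith

/-- The point of the diagram given by the convex hull of finitely many points of the triangle with
barycentric coordinates `x k`: the points meet all three sides, so `R = 1`; the differences of
consecutive coordinates fill intervals of length at most `d`, one of them exactly; three of the
points form a homothet of size `ρ`; and three half-planes certify that no larger one fits. -/
lemma exists_convexBody (h : IsCenteredFrame p ℓ) {ι : Type*} [Finite ι] {x : ι → Fin 3 → ℝ}
    {d ρ : ℝ} (hd0 : 0 < d) (hρ : 0 ≤ ρ) (hsum : ∀ k, x k 0 + x k 1 + x k 2 = 1)
    (hnn : ∀ k i, 0 ≤ x k i) (hzero : ∀ i, ∃ k, x k i = 0) {lo : Fin 3 → ℝ}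
    (hlo : ∀ k i, lo i ≤ x k i - x k (i + 1)) (hhi : ∀ k i, x k i - x k (i + 1) ≤ lo i + d)
    (hatt : ∃ k l, (x k 0 - x k 1) - (x l 0 - x l 1) = d) {y : Fin 3 → ℝ}
    (hy : ∀ i, ∃ k, ∀ j, x k j = y j + if j = i then ρ else 0) {n : Fin 3 → Fin 3 → ℝ}
    {c : Fin 3 → ℝ} (hn : ∀ j, n 0 j + n 1 j + n 2 j = 0)
    (hc : ∀ k l, n k 0 * x l 0 + n k 1 * x l 1 + n k 2 * x l 2 ≤ c k)
    (hpos : 0 < n 0 0 + n 1 1 + n 2 2) (hle : c 0 + c 1 + c 2 ≤ ρ * (n 0 0 + n 1 1 + n 2 2)) :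
    (ρ, d / 2) ∈ diagramMax (convexHull ℝ (Set.range p)) := by
  set v : ι → Pl := fun k => x k 0 • p 0 + x k 1 • p 1 + x k 2 • p 2 with hv
  have hℓ : ∀ k i, ℓ i (v k) = x k i - 1 / 3 := fun k i => h.coord_combination _ (hsum k) i
  set K := convexHull ℝ (Set.range v) with hK
  have hcK : IsCompact K := isCompact_convexHull_range v
  have hKc : Convex ℝ K := convex_convexHull ℝ _
  have hvK : ∀ k, v k ∈ K := fun k => subset_convexHull ℝ _ ⟨k, rfl⟩
  obtain ⟨k₀, l₀, hkl⟩ := hatt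
  have hne : v k₀ ≠ v l₀ := fun he => by
    have h0 := hℓ k₀ 0
    have h1 := hℓ k₀ 1
    rw [he, hℓ] at h0 h1
    linarith
  have hR : circumradius K (convexHull ℝ (Set.range p)) = 1 := by
    choose z hz using hzero
    rw [h.circumradius_eq (q := fun i => v (z i)) (fun i => hvK _)]
    · simp only [hℓ, hz]
      norm_num
    · intro i w hw
      have := le_of_mem_convexHull (f := -ℓ i) (c := 1 / 3) (by
        rintro _ ⟨k, rfl⟩
        rw [LinearMap.neg_apply, hℓ]
        linarith [hnn k i]) hw
      rw [LinearMap.neg_apply] at this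
      rw [hℓ, hz]
      linarith
  have hD : diameterMax K (convexHull ℝ (Set.range p)) = d := by
    apply le_antisymm
    · have h1 : ∀ w ∈ K, ∀ i, ℓ i w - ℓ (i + 1) w ≤ lo i + d := fun w hw i =>
        le_of_mem_convexHull (f := ℓ i - ℓ (i + 1)) (by
          rintro _ ⟨k, rfl⟩
          rw [LinearMap.sub_apply, hℓ, hℓ]
          linarith [hhi k i]) hw
      have h2 : ∀ w ∈ K, ∀ i, ℓ (i + 1) w - ℓ i w ≤ -lo i := fun w hw i =>
        le_of_mem_convexHull (f := ℓ (i + 1) - ℓ i) (by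
          rintro _ ⟨k, rfl⟩
          rw [LinearMap.sub_apply, hℓ, hℓ]
          linarith [hlo k i]) hw
      refine h.diameterMax_le ⟨_, hvK k₀⟩ fun w hw z hz i j => ?_
      have h3 : ∀ i, (ℓ i w - ℓ (i + 1) w) - (ℓ i z - ℓ (i + 1) z) ≤ d := fun i => by
        linarith [h1 w hw i, h2 z hz i]
      have h4 : ∀ i, (ℓ (i + 1) w - ℓ i w) - (ℓ (i + 1) z - ℓ i z) ≤ d := fun i => by
        linarith [h1 z hz i, h2 w hw i]
      -- Two distinct indices modulo 3 are consecutive, in one order or the other.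
      have h5 : j = i ∨ j = i + 1 ∨ i = j + 1 := by decide +revert
      rcases h5 with rfl | rfl | rfl
      · linarith
      · exact h3 i
      · exact h4 j
    · have := h.le_diameterMax hcK (hvK k₀) (hvK l₀) (i := 0) (j := 1) (by decide)
      simp only [hℓ] at this
      linarith
  have hr : inradius K (convexHull ℝ (Set.range p)) = ρ := by
    apply le_antisymm
    · refine inradius_le (n := fun k => n k 0 • ℓ 0 + n k 1 • ℓ 1 + n k 2 • ℓ 2)
        (c := fun k => c k - (n k 0 + n k 1 + n k 2) / 3) hρ (fun w => ?_) (fun k w hw => ?_) ?_ ?_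
      · simp only [LinearMap.add_apply, LinearMap.smul_apply, smul_eq_mul]
        linear_combination ℓ 0 w * hn 0 + ℓ 1 w * hn 1 + ℓ 2 w * hn 2
      · refine le_of_mem_convexHull ?_ hw
        rintro _ ⟨l, rfl⟩
        simp only [LinearMap.add_apply, LinearMap.smul_apply, smul_eq_mul, hℓ]
        linarith [hc k l]
      · simp [h.coord_vertex]
        linarith [hn 0, hn 1, hn 2]
      · have hs : n 0 0 + n 1 1 + n 2 2 = (n 0 0 * (2 / 3) + n 0 1 * (-1 / 3) + n 0 2 * (-1 / 3))
            + (n 1 0 * (-1 / 3) + n 1 1 * (2 / 3) + n 1 2 * (-1 / 3))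
            + (n 2 0 * (-1 / 3) + n 2 1 * (-1 / 3) + n 2 2 * (2 / 3)) := by
          linarith [hn 0, hn 1, hn 2]
        rw [hs] at hle
        simp [h.coord_vertex] at hle ⊢
        linarith [hn 0, hn 1, hn 2]
    · refine h.le_inradius hKc hcK hρ (t := y 0 • p 0 + y 1 • p 1 + y 2 • p 2) fun i => ?_
      obtain ⟨k, hk⟩ := hy i
      convert hvK k using 1
      simp only [hv, hk]
      fin_cases i <;> simp [add_smul] <;> abel
  refine ⟨⟨K, hKc, hcK, ⟨_, hvK k₀⟩⟩, ⟨_, hvK k₀, _, hvK l₀, hne⟩, ?_⟩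
  change (ρ, d / 2) = diagramMapMax K _
  rw [diagramMapMax, hR, hD, hr, mul_one, div_one]

/-- The position of the homothet of size `r` used for diameters up to `3 / 2`: its vertices have
barycentric coordinates `(y + r, z, y)`, `(y, z + r, y)` and `(y, z, y + r)`. The homothet inscribed
in the triangle extremal for `contact_inequality`, of size `1 / 4 - t ^ 2`, is moved linearly to one
of size `(1 + t) / 2`, whose width is as large as the diameter `1 + t` permits. -/
lemma exists_homothet_position {t r : ℝ} (ht : 0 ≤ t) (ht' : t ≤ 1 / 2)
    (hr : 1 / 4 - t ^ 2 ≤ r) (hr' : r ≤ (1 + t) / 2) :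
    ∃ y z, 0 ≤ y ∧ 0 ≤ z ∧ y + z + y = 1 - r ∧ -1 / 2 - t ≤ y - z - r ∧ y - z + r ≤ 1 / 2 ∧
      (1 / 2 - t) * z ≤ (1 / 2 + t) * r ∧ 1 / 2 + t ≤ z + r := by
  obtain ⟨θ, hθ, hθ', rfl⟩ : ∃ θ : ℝ, 0 ≤ θ ∧ θ ≤ 1 ∧
      r = (1 - θ) * (1 / 4 - t ^ 2) + θ * ((1 + t) / 2) := by
    have hpos : 0 < (1 + t) / 2 - (1 / 4 - t ^ 2) := by nlinarith
    refine ⟨(r - (1 / 4 - t ^ 2)) / ((1 + t) / 2 - (1 / 4 - t ^ 2)),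
      div_nonneg (by linarith) hpos.le, (div_le_one hpos).2 (by linarith), ?_⟩
    have := div_mul_cancel₀ (r - (1 / 4 - t ^ 2)) hpos.ne'
    linear_combination -this
  clear hr hr'
  -- The conditions are affine in `θ`, with coefficients that are nonnegative combinations of
  -- the Bernstein polynomials of `[0, 1 / 2]`.
  have e1 := mul_nonneg hθ (sq_nonneg t)
  have e2 := mul_nonneg hθ (mul_nonneg ht (sub_nonneg.2 ht'))
  have e3 := mul_nonneg hθ (sq_nonneg (1 / 2 - t))
  have hθ'' := sub_nonneg.2 hθ'
  have e4 := mul_nonneg hθ'' (sq_nonneg t)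
  have e5 := mul_nonneg hθ'' (mul_nonneg ht (sub_nonneg.2 ht'))
  have e6 := mul_nonneg hθ'' (sq_nonneg (1 / 2 - t))
  refine ⟨(1 - 2 * t) * (1 / 4 - θ / 12), (1 - θ) * (1 / 2 + t) ^ 2 + θ * ((1 + t) / 6),
    by linarith, by linarith, by ring, by linarith, by linarith, by linarith, by linarith⟩

set_option maxHeartbeats 1000000 in
/-- Diameters up to `3 / 2`. The first three points span the contact triangle that is extremal for
`contact_inequality`; the other three are the vertices of the homothet of size `r`. The side of the
contact triangle opposite to its `k`-th point never passes the `k`-th vertex of the homothet, so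
the normals of the sides certify the inradius. -/
lemma mem_diagramMax_of_le (h : IsCenteredFrame p ℓ) {t r : ℝ} (ht : 0 ≤ t) (ht' : t ≤ 1 / 2)
    (hr : 1 / 4 - t ^ 2 ≤ r) (hr' : r ≤ (1 + t) / 2) :
    (r, (1 + t) / 2) ∈ diagramMax (convexHull ℝ (Set.range p)) := by
  obtain ⟨y, z, hy0, hz0, hyz, b1, b2, s1, s2'⟩ := exists_homothet_position ht ht' hr hr'
  have hr0 : 0 ≤ r := by nlinarith
  have s2 := mul_le_mul_of_nonneg_left s2' (sub_nonneg.2 ht')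
  clear hr
  have s3 : 0 ≤ (1 / 2 - t) * r := mul_nonneg (by linarith) hr0
  have s4 : 0 ≤ (1 / 2 + t) * r := mul_nonneg (by linarith) hr0
  have s5 : 0 ≤ (1 / 2 - t) * (1 / 2 + t) := mul_nonneg (by linarith) (by linarith)
  refine h.exists_convexBody (ι := Fin 6)
    (x := ![![0, 1 / 2 + t, 1 / 2 - t], ![1 / 2, 0, 1 / 2], ![1 / 2 - t, 1 / 2 + t, 0],
      ![y + r, z, y], ![y, z + r, y], ![y, z, y + r]])
    (lo := ![-1 / 2 - t, -1 / 2, -(1 + t) / 2]) (y := ![y, z, y])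
    (n := ![![1 / 2 + t, -(1 / 2 - t), -(1 / 2 + t)], ![0, 2 * (1 / 2 - t), 0],
      ![-(1 / 2 + t), -(1 / 2 - t), 1 / 2 + t]])
    (c := ![(1 / 2 + t) * r - (1 / 2 - t) * z, 2 * (1 / 2 - t) * (z + r),
      (1 / 2 + t) * r - (1 / 2 - t) * z])
    (by linarith) hr0 ?_ ?_ ?_ ?_ ?_ ⟨1, 0, ?_⟩ ?_ ?_ ?_ ?_ ?_
  · intro k
    fin_cases k <;> simp <;> linarith
  · intro k i
    fin_cases k <;> fin_cases i <;> simp <;> linarith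
  · intro i
    fin_cases i
    · exact ⟨0, by simp⟩
    · exact ⟨1, by simp⟩
    · exact ⟨2, by simp⟩
  · intro k i
    fin_cases k <;> fin_cases i <;> simp <;> linarith
  · intro k i
    fin_cases k <;> fin_cases i <;> simp <;> linarith
  · simp
    ring
  · intro i
    fin_cases i
    · exact ⟨3, fun j => by fin_cases j <;> simp⟩
    · exact ⟨4, fun j => by fin_cases j <;> simp⟩
    · exact ⟨5, fun j => by fin_cases j <;> simp⟩
  · intro j
    fin_cases j <;> simp <;> ring
  · intro k l
    fin_cases k <;> fin_cases l <;> simp <;> linarith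
  · simp
    linarith
  · simp
    linarith

/-- Diameters from `3 / 2` on. The body is the convex hull of a segment, from a vertex to the point
dividing the opposite side in the ratio `a : 1 - a`, and a homothet of size `r` at that vertex. It
lies in the strip spanned by the homothet in the direction of the segment, which certifies the
inradius. -/
lemma mem_diagramMax_of_ge (h : IsCenteredFrame p ℓ) {a r : ℝ} (ha : 1 / 2 ≤ a) (ha' : a ≤ 1)
    (hr : 0 ≤ r) (hr' : r ≤ (1 + a) / 2) :
    (r, (1 + a) / 2) ∈ diagramMax (convexHull ℝ (Set.range p)) := by
  have h1 : 0 ≤ a * r := mul_nonneg (by linarith) hr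
  have h2 : 0 ≤ (1 - a) * r := mul_nonneg (by linarith) hr
  refine h.exists_convexBody (ι := Fin 4)
    (x := ![![1, 0, 0], ![1 - r, r, 0], ![1 - r, 0, r], ![0, a, 1 - a]])
    (lo := ![-a, -(1 + a) / 2, -1]) (y := ![1 - r, 0, 0])
    (n := ![![0, 0, 0], ![0, 1 - a, -a], ![0, -(1 - a), a]])
    (c := ![0, (1 - a) * r, a * r])
    (by linarith) hr ?_ ?_ ?_ ?_ ?_ ⟨0, 3, ?_⟩ ?_ ?_ ?_ ?_ ?_
  · intro k
    fin_cases k <;> simp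
  · intro k i
    fin_cases k <;> fin_cases i <;> simp <;> linarith
  · intro i
    fin_cases i
    · exact ⟨3, by simp⟩
    · exact ⟨0, by simp⟩
    · exact ⟨0, by simp⟩
  · intro k i
    fin_cases k <;> fin_cases i <;> simp <;> linarith
  · intro k i
    fin_cases k <;> fin_cases i <;> simp <;> linarith
  · simp
  · intro i
    fin_cases i
    · exact ⟨0, fun j => by fin_cases j <;> simp⟩
    · exact ⟨1, fun j => by fin_cases j <;> simp⟩
    · exact ⟨2, fun j => by fin_cases j <;> simp⟩
  · intro j
    fin_cases j <;> simp
  · intro k l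
    fin_cases k <;> fin_cases l <;> simp <;> linarith
  · simp
  · simp
    linarith

end IsCenteredFrame

theorem mainTheorem4 (S : Set (EuclideanSpace ℝ (Fin 2)))
    (hS : IsTriangle S) (hc : IsMinkowskiCentered S) :
    diagramMax S =
      {p : ℝ × ℝ | ∃ r R D : ℝ, 0 < R ∧ p = (r / R, D / (2 * R)) ∧
        D / 2 ≤ R ∧
        r ≤ D / 2 ∧
        0 ≤ r ∧
        R ≤ D ∧
        (D / R - 1 / 2) * (3 / 2 - D / R) ≤ r / R} := by
  obtain ⟨p, ℓ, h, rfl⟩ := exists_isCenteredFrame hS hc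
  ext P
  constructor
  · rintro ⟨K, hnt, rfl⟩
    obtain ⟨hR, hineq⟩ := h.diagram_inequalities K.convex K.isCompact hnt
    exact ⟨_, _, _, hR, rfl, hineq⟩
  · rintro ⟨r, R, D, hR, rfl, h1, h2, h3, h4, h5⟩
    have e1 : D / R ≤ 2 := by rw [div_le_iff₀ hR]; linarith
    have e2 : r / R ≤ D / R / 2 := by
      rw [div_div, mul_comm, ← div_div]
      exact div_le_div_of_nonneg_right h2 hR.le
    have e3 : 0 ≤ r / R := div_nonneg h3 hR.le
    have e4 : 1 ≤ D / R := by rw [le_div_iff₀ hR]; linarith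
    have e5 : D / (2 * R) = (1 + (D / R - 1)) / 2 := by
      rw [mul_comm, ← div_div]
      ring
    rw [e5]
    rcases le_total (D / R) (3 / 2) with hd | hd
    · refine h.mem_diagramMax_of_le (by linarith) (by linarith) ?_ (by linarith)
      linarith
    · exact h.mem_diagramMax_of_ge (by linarith) (by linarith) e3 (by linarith)
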